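/- Let $K\subset\overline{\mathbb{R}}=\mathbb{R}\cup\{\pm\infty\}$ be a non-empty compact set and let $\mathcal{V}=(\nu_n)_{n\in\mathbb{N}}$, $\mathbb{N}=\{1,2,\dots\}$, be a family of continuous functions $\nu_n\colon\mathbb{C}\to(0,\infty)$ with $\nu_n\le\nu_{n+1}$ for all $n$. For $n\in\mathbb{N}$ let $U_n(K)\subset\mathbb{C}$ be the open set $$U_n(K)=\{z\in\mathbb{C} : \mathrm{d}(z,K\cap\mathbb{R})<1/n\}\cup S_n^{+}\cup S_n^{-}$$ (the first set being empty if $K\cap\mathbb{R}=\varnothing$), where $S_n^{+}=(n,\infty)+i(-1/n,1/n)$ if $\infty\in K$ and $S_n^{+}=\varnothing$ otherwise, and $S_n^{-}=(-\infty,-n)+i(-1/n,1/n)$ if $-\infty\in K$ and $S_n^{-}=\varnothing$ otherwise. Let $$\mathcal{O}\nu_n^{-1}(\overline{U_n(K)})=\{f\in\mathcal{O}(U_n(K))\cap\mathcal{C}(\overline{U_n(K)}) : \|f\|_n<\infty\},\qquad \|f\|_n=\sup_{z\in\overline{U_n(K)}}|f(z)|\,\nu_n(z)^{-1},$$ and for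 $n\le k$ let $\pi_{n,k}\colon\mathcal{O}\nu_n^{-1}(\overline{U_n(K)})\to\mathcal{O}\nu_k^{-1}(\overline{U_k(K)})$ be the restriction map. Suppose that for every $n\in\mathbb{N}$ there is $m>n$ such that for every $\varepsilon>0$ there is a compact set $Q\subset\overline{U_m(K)}$ with $\nu_n(z)\le\varepsilon\,\nu_m(z)$ for all $z\in\overline{U_m(K)}\setminus Q$. Then the following hold. a) The locally convex inductive limit $\mathcal{OV}^{-1}_{\mathrm{ind}}(K)=\varinjlim_{n}\mathcal{O}\nu_n^{-1}(\overline{U_n(K)})$ along the maps $\pi_{n,k}$ exists, i.e. the canonical maps from the steps into the algebraic inductive limit are injective and the finest locally convex topology making all of them continuous is Hausdorff; and it is a (DFS)-space, i.e. a Hausdorff space that is the locally convex inductive limit of a sequence of complex Banach spaces with injective compact linking maps. b) For every $x_0\in K\cap\mathbb{R}$ and $m\in\mathbb{N}_0$ the point evaluation $\delta^{(m)}_{x_0}f=f^{(m)}(x_0)$ of the $m$-th complex derivative is a continuous linear functional on $\mathcal{OV}^{-1}_{\mathrm{ind}}(K)$. If $K\subset\mathbb{R}$ or if $K\cap\{\pm\infty\}$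 contains no isolated points of $K$, then the span of $\{\delta^{(m)}_{x_0} : x_0\in K\cap\mathbb{R},\ m\in\mathbb{N}_0\}$ is dense in the strong dual $\mathcal{OV}^{-1}_{\mathrm{ind}}(K)_b'$ (the topological dual with the topology of uniform convergence on bounded sets). c) If $K$ has no isolated points, then the span of $\{\delta_{x_0} : x_0\in K\cap\mathbb{R}\}$, $\delta_{x_0}f=f(x_0)$, is dense in $\mathcal{OV}^{-1}_{\mathrm{ind}}(K)_b'$. -/

import Mathlib

open Set Topology Filter

noncomputable section

namespace WeightedGerms

universe u v w

/-! ### Inductive limits of locally convex spaces and (DFS)-spaces -/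

/-- The locally convex inductive (final) topology on the complex vector space `E` with respect to
linear maps `j i : X i → E`: the finest locally convex vector space topology that makes every
`j i` continuous. -/
@[reducible] def inductiveTopology {ι : Type u} {X : ι → Type v} {E : Type w}
    [∀ i, NormedAddCommGroup (X i)] [∀ i, NormedSpace ℂ (X i)]
    [AddCommGroup E] [Module ℂ E] (j : ∀ i, X i →ₗ[ℂ] E) : TopologicalSpace E :=
  sInf {t | @IsTopologicalAddGroup E t _ ∧ @ContinuousSMul ℂ E _ _ t ∧
    @LocallyConvexSpace ℝ E _ _ _ _ t ∧ ∀ i, @Continuous (X i) E _ t (j i)}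

section
variable {ι : Type u} {X : ι → Type v} {E : Type w}
    [∀ i, NormedAddCommGroup (X i)] [∀ i, NormedSpace ℂ (X i)]
    [AddCommGroup E] [Module ℂ E] (j : ∀ i, X i →ₗ[ℂ] E)

theorem inductiveTopology_isTopologicalAddGroup :
    @IsTopologicalAddGroup E (inductiveTopology j) _ :=
  topologicalAddGroup_sInf fun _ ht => ht.1

theorem inductiveTopology_continuousSMul :
    @ContinuousSMul ℂ E _ _ (inductiveTopology j) :=
  continuousSMul_sInf fun _ ht => ht.2.1

theorem inductiveTopology_locallyConvexSpace :
    @LocallyConvexSpace ℝ E _ _ _ _ (inductiveTopology j) :=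
  LocallyConvexSpace.sInf fun _ ht => ht.2.2.1

theorem continuous_inductiveTopology (i : ι) :
    @Continuous (X i) E _ (inductiveTopology j) (j i) :=
  continuous_sInf_rng.2 fun _ ht => ht.2.2.2 i

end

/-- `E` is a (DFS)-space: a Hausdorff space that is the locally convex inductive limit of a
sequence `X 0 → X 1 → X 2 → ⋯` of Banach spaces with injective compact linking maps `s k`.
The `j k : X k → E` are the (injective) canonical maps into the limit. -/
def IsDFSSpace (E : Type u) [AddCommGroup E] [Module ℂ E] [t : TopologicalSpace E] : Prop :=
  T2Space E ∧
  ∃ (X : ℕ → Type u) (_ : ∀ k, NormedAddCommGroup (X k)) (_ : ∀ k, NormedSpace ℂ (X k))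
    (s : ∀ k, X k →L[ℂ] X (k + 1)) (j : ∀ k, X k →ₗ[ℂ] E),
    (∀ k, CompleteSpace (X k)) ∧
    (∀ k, Function.Injective (s k)) ∧
    (∀ k, IsCompactOperator (s k)) ∧
    (∀ k x, j (k + 1) (s k x) = j k x) ∧
    (∀ k, Function.Injective (j k)) ∧
    (∀ e : E, ∃ k x, j k x = e) ∧
    t = inductiveTopology j

/-! ### Weights and the neighbourhoods `U_t(K)` -/

/-- A directed family of continuous weights `ν₁ ≤ ν₂ ≤ ⋯` on `ℂ`. -/
structure Weights where
  /-- the weight functions -/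
  toFun : ℕ+ → ℂ → ℝ
  continuous' : ∀ n, Continuous (toFun n)
  pos' : ∀ n z, 0 < toFun n z
  mono' : ∀ m n, m ≤ n → ∀ z, toFun m z ≤ toFun n z

instance : CoeFun Weights (fun _ => ℕ+ → ℂ → ℝ) := ⟨Weights.toFun⟩

/-- `K ∩ ℂ = K ∩ ℝ`, as a subset of `ℂ`, for `K ⊆ [-∞, ∞]`. -/
def finitePart (K : Set EReal) : Set ℂ := {z | ∃ x : ℝ, (x : EReal) ∈ K ∧ z = x}

/-- The open set `U_t(K) ⊆ ℂ`: the open `1/t`-neighbourhood of `K ∩ ℂ` (empty if `K ∩ ℂ` is),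
together with the half-strip `(t, ∞) + i(-1/t, 1/t)` if `∞ ∈ K` and the half-strip
`(-∞, -t) + i(-1/t, 1/t)` if `-∞ ∈ K`. -/
def U (K : Set EReal) (t : ℝ) : Set ℂ :=
  Metric.thickening (1 / t) (finitePart K) ∪
    {z | (⊤ : EReal) ∈ K ∧ t < z.re ∧ |z.im| < 1 / t} ∪
    {z | (⊥ : EReal) ∈ K ∧ z.re < -t ∧ |z.im| < 1 / t}

/-- For every `n` there is `m > n` such that `ν n / ν m` vanishes at infinity on the closure of
`U_m(K)`. -/
def WeightCondition (ν : Weights) (K : Set EReal) : Prop :=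
  ∀ n : ℕ+, ∃ m : ℕ+, n < m ∧ ∀ ε : ℝ, 0 < ε →
    ∃ Q : Set ℂ, IsCompact Q ∧ Q ⊆ closure (U K m) ∧
      ∀ z ∈ closure (U K m) \ Q, ν n z ≤ ε * ν m z

theorem U_anti (K : Set EReal) {s t : ℝ} (hs : 0 < s) (h : s ≤ t) : U K t ⊆ U K s := by
  have h1 : 1 / t ≤ 1 / s := one_div_le_one_div_of_le hs h
  rintro z ((hz | hz) | hz)
  · exact Or.inl (Or.inl (Metric.thickening_mono h1 _ hz))
  · exact Or.inl (Or.inr ⟨hz.1, h.trans_lt hz.2.1, hz.2.2.trans_le h1⟩)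
  · exact Or.inr ⟨hz.1, hz.2.1.trans_le (neg_le_neg h), hz.2.2.trans_le h1⟩

theorem U_anti_pnat (K : Set EReal) {n k : ℕ+} (h : n ≤ k) : U K k ⊆ U K n :=
  U_anti K (by exact_mod_cast n.pos) (by exact_mod_cast h)

/-! ### The weighted spaces of holomorphic functions -/

/-- Functions on the closure of `U_n(K)`, represented by their extension by zero to `ℂ`, that are
continuous there, holomorphic on `U_n(K)`, and with `|f| / ν n` bounded on the closure. -/
def OSubmodule (ν : Weights) (K : Set EReal) (n : ℕ+) : Submodule ℂ (ℂ → ℂ) where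
  carrier := {f | DifferentiableOn ℂ f (U K n) ∧ ContinuousOn f (closure (U K n)) ∧
    (∃ C : ℝ, ∀ z ∈ closure (U K n), ‖f z‖ * (ν n z)⁻¹ ≤ C) ∧
    ∀ z, z ∉ closure (U K n) → f z = 0}
  zero_mem' := ⟨differentiableOn_const 0, continuousOn_const, ⟨0, by simp⟩, fun _ _ => rfl⟩
  add_mem' := by
    rintro f g ⟨hf1, hf2, ⟨C, hC⟩, hf4⟩ ⟨hg1, hg2, ⟨D, hD⟩, hg4⟩
    refine ⟨hf1.add hg1, hf2.add hg2, ⟨C + D, fun z hz => ?_⟩, fun z hz => ?_⟩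
    · have hp : 0 ≤ (ν n z)⁻¹ := (inv_pos.2 (ν.pos' n z)).le
      calc ‖f z + g z‖ * (ν n z)⁻¹ ≤ (‖f z‖ + ‖g z‖) * (ν n z)⁻¹ :=
            mul_le_mul_of_nonneg_right (norm_add_le _ _) hp
        _ = ‖f z‖ * (ν n z)⁻¹ + ‖g z‖ * (ν n z)⁻¹ := add_mul _ _ _
        _ ≤ C + D := add_le_add (hC z hz) (hD z hz)
    · simp [hf4 z hz, hg4 z hz]
  smul_mem' := by
    rintro c f ⟨hf1, hf2, ⟨C, hC⟩, hf4⟩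
    refine ⟨hf1.const_smul c, hf2.const_smul c, ⟨‖c‖ * C, fun z hz => ?_⟩, fun z hz => ?_⟩
    · simp only [Pi.smul_apply, norm_smul, mul_assoc]
      exact mul_le_mul_of_nonneg_left (hC z hz) (norm_nonneg _)
    · simp [hf4 z hz]

/-- The space `𝒪ν_n⁻¹(closure (U_n(K)))`. -/
def OSpace (ν : Weights) (K : Set EReal) (n : ℕ+) : Type := ↥(OSubmodule ν K n)

namespace OSpace

variable {ν : Weights} {K : Set EReal} {n : ℕ+}

instance : AddCommGroup (OSpace ν K n) := inferInstanceAs (AddCommGroup (OSubmodule ν K n))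

instance : Module ℂ (OSpace ν K n) := inferInstanceAs (Module ℂ (OSubmodule ν K n))

instance : CoeFun (OSpace ν K n) (fun _ => ℂ → ℂ) := ⟨fun f => f.1⟩

/-- `‖f‖_n = sup |f(z)| ν_n(z)⁻¹` over `z` in the closure of `U_n(K)`. -/
instance : Norm (OSpace ν K n) := ⟨fun f => ⨆ z : closure (U K n), ‖f z‖ * (ν n z)⁻¹⟩

theorem norm_def (f : OSpace ν K n) :
    ‖f‖ = ⨆ z : closure (U K n), ‖f z‖ * (ν n z)⁻¹ := rfl

theorem term_nonneg (f : OSpace ν K n) (z : ℂ) : 0 ≤ ‖f z‖ * (ν n z)⁻¹ :=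
  mul_nonneg (norm_nonneg _) (inv_pos.2 (ν.pos' n z)).le

theorem le_norm (f : OSpace ν K n) {z : ℂ} (hz : z ∈ closure (U K n)) :
    ‖f z‖ * (ν n z)⁻¹ ≤ ‖f‖ := by
  obtain ⟨C, hC⟩ := f.2.2.2.1
  exact le_ciSup (f := fun z : closure (U K n) => ‖f z‖ * (ν n z)⁻¹)
    ⟨C, by rintro _ ⟨w, rfl⟩; exact hC w w.2⟩ ⟨z, hz⟩

theorem norm_le {f : OSpace ν K n} {C : ℝ} (h0 : 0 ≤ C)
    (h : ∀ z ∈ closure (U K n), ‖f z‖ * (ν n z)⁻¹ ≤ C) : ‖f‖ ≤ C :=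
  Real.iSup_le (fun z => h z z.2) h0

theorem norm_nonneg' (f : OSpace ν K n) : 0 ≤ ‖f‖ := Real.iSup_nonneg fun z => term_nonneg f z

theorem core : NormedSpace.Core ℂ (OSpace ν K n) where
  norm_nonneg := norm_nonneg'
  norm_smul c f := by
    have h : ∀ z : ℂ, ‖(c • f : OSpace ν K n) z‖ = ‖c‖ * ‖f z‖ := fun z => norm_smul c (f z)
    simp only [norm_def, h, mul_assoc]
    exact (Real.mul_iSup_of_nonneg (norm_nonneg c) _).symm
  norm_triangle f g := by
    refine norm_le (add_nonneg (norm_nonneg' f) (norm_nonneg' g)) fun z hz => ?_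
    calc ‖f z + g z‖ * (ν n z)⁻¹ ≤ (‖f z‖ + ‖g z‖) * (ν n z)⁻¹ :=
          mul_le_mul_of_nonneg_right (norm_add_le _ _) (inv_pos.2 (ν.pos' n z)).le
      _ = ‖f z‖ * (ν n z)⁻¹ + ‖g z‖ * (ν n z)⁻¹ := add_mul _ _ _
      _ ≤ ‖f‖ + ‖g‖ := add_le_add (le_norm f hz) (le_norm g hz)
  norm_eq_zero_iff f := by
    constructor
    · intro h
      refine Subtype.ext (funext fun z => ?_)
      by_cases hz : z ∈ closure (U K n)
      · have h1 := le_norm f hz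
        rw [h] at h1
        have h2 : ‖f z‖ ≤ 0 := nonpos_of_mul_nonpos_left h1 (inv_pos.2 (ν.pos' n z))
        exact norm_le_zero_iff.1 h2
      · exact f.2.2.2.2 z hz
    · rintro rfl
      refine le_antisymm (norm_le le_rfl fun z _ => ?_) (norm_nonneg' _)
      change ‖(0 : ℂ)‖ * _ ≤ 0
      simp

instance : NormedAddCommGroup (OSpace ν K n) := NormedAddCommGroup.ofCore core

instance : NormedSpace ℂ (OSpace ν K n) := NormedSpace.ofCore core

end OSpace

/-- The spectral map `π_{n,k}`, `n ≤ k`: restriction to the closure of `U_k(K)` (followed by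
extension by zero, the chosen representation of functions on that set). -/
def restrict (ν : Weights) (K : Set EReal) (n k : ℕ+) (h : n ≤ k) :
    OSpace ν K n →ₗ[ℂ] OSpace ν K k where
  toFun f := ⟨(closure (U K k)).indicator f, by
    have hU := U_anti_pnat K h
    have he : EqOn ((closure (U K k)).indicator f) f (closure (U K k)) :=
      fun z hz => Set.indicator_of_mem hz _
    refine ⟨(f.2.1.mono hU).congr (he.mono subset_closure),
      (f.2.2.1.mono (closure_mono hU)).congr he, ⟨‖f‖, fun z hz => ?_⟩,
      fun z hz => Set.indicator_of_notMem hz _⟩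
    rw [he hz]
    exact (mul_le_mul_of_nonneg_left (inv_anti₀ (ν.pos' n z) (ν.mono' n k h z))
      (norm_nonneg _)).trans (OSpace.le_norm f (closure_mono hU hz))⟩
  map_add' f g := Subtype.ext (Set.indicator_add _ _ _)
  map_smul' c f := Subtype.ext (Set.indicator_const_smul (closure (U K k)) c f.1)

theorem restrict_apply {ν : Weights} {K : Set EReal} {n k : ℕ+} (h : n ≤ k) (f : OSpace ν K n)
    {z : ℂ} (hz : z ∈ closure (U K k)) : restrict ν K n k h f z = f z :=
  Set.indicator_of_mem hz _

instance (ν : Weights) (K : Set EReal) :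
    DirectedSystem (OSpace ν K) (fun n k h => restrict ν K n k h) where
  map_self n f := Subtype.ext (Set.indicator_eq_self.2 fun z hz => by
    by_contra hz'
    exact hz (f.2.2.2.2 z hz'))
  map_map l k n hnk hkl f := Subtype.ext (by
    change (closure (U K l)).indicator ((closure (U K k)).indicator f) =
      (closure (U K l)).indicator f
    rw [Set.indicator_indicator, inter_eq_left.2 (closure_mono (U_anti_pnat K hkl))])

/-! ### The inductive limit -/

/-- The inductive limit `𝒪𝒱⁻¹_ind(K)` of the spaces `𝒪ν_n⁻¹(closure (U_n(K)))` along the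
restriction maps. -/
def OVind (ν : Weights) (K : Set EReal) : Type :=
  Module.DirectLimit (OSpace ν K) (restrict ν K)

namespace OVind

instance (ν : Weights) (K : Set EReal) : AddCommGroup (OVind ν K) :=
  inferInstanceAs (AddCommGroup (Module.DirectLimit (OSpace ν K) (restrict ν K)))

instance (ν : Weights) (K : Set EReal) : Module ℂ (OVind ν K) :=
  inferInstanceAs (Module ℂ (Module.DirectLimit (OSpace ν K) (restrict ν K)))

/-- The canonical map of the `n`-th step into the inductive limit. -/
def of (ν : Weights) (K : Set EReal) (n : ℕ+) : OSpace ν K n →ₗ[ℂ] OVind ν K :=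
  Module.DirectLimit.of ℂ ℕ+ (OSpace ν K) (restrict ν K) n

instance (ν : Weights) (K : Set EReal) : TopologicalSpace (OVind ν K) :=
  inductiveTopology (of ν K)

instance (ν : Weights) (K : Set EReal) : IsTopologicalAddGroup (OVind ν K) :=
  inductiveTopology_isTopologicalAddGroup _

instance (ν : Weights) (K : Set EReal) : ContinuousSMul ℂ (OVind ν K) :=
  inductiveTopology_continuousSMul _

instance (ν : Weights) (K : Set EReal) : LocallyConvexSpace ℝ (OVind ν K) :=
  inductiveTopology_locallyConvexSpace _

end OVind

/-- The functional `T` in the strong dual is the point evaluation `δ_x^{(m)} f = f^{(m)}(x)` of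
the `m`-th complex derivative at `x`. -/
def IsPointEvaluation {ν : Weights} {K : Set EReal} (T : StrongDual ℂ (OVind ν K)) (x : ℝ)
    (m : ℕ) : Prop :=
  ∀ (n : ℕ+) (f : OSpace ν K n), T (OVind.of ν K n f) = iteratedDeriv m f (x : ℂ)

end WeightedGerms

end

/-! The weight condition makes suitable linking maps compact. On a compact `Q` inside the larger
open set, Cauchy-type bounds and Arzelà–Ascoli make the unit ball totally bounded; off `Q` the
quotient of the weights is small (`isCompactOperator_restrictL`). Along a cofinal subsequence the
limit is thus a union of Banach spaces with compact injective contractions (`IsCompactUnion`).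

The abstract part rests on `exists_nhds_avoiding`: a growing sequence of compact absolutely convex
sets, each absorbing a ball of the preceding step, has as its union a zero neighbourhood that misses
prescribed points. Hence every bounded set lies and is bounded in one step
(`exists_subset_image_closedBall`), and the limit is Hausdorff.

Density in the strong dual then reduces to separation of points. On a bounded set, a functional
factors through a compact linking map, and a compactness argument with Hahn–Banach approximates it
uniformly by combinations of any separating family (`exists_sum_approx_of_separating`). Point
evaluations separate points by the identity theorem: every piece of `U K n` is a ball about a point
of `K` or a half-strip, and a half-strip contains points of `K` when the infinite point is not
isolated. -/

noncomputable section

namespace WeightedGerms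

universe u v w

/-! ### Inductive limits of normed spaces -/

section InductiveTopology

variable {ι : Type u} {X : ι → Type v} {E : Type w}
    [∀ i, NormedAddCommGroup (X i)] [∀ i, NormedSpace ℂ (X i)]
    [AddCommGroup E] [Module ℂ E] {j : ∀ i, X i →ₗ[ℂ] E}

/-- Absolutely convex sets whose preimages in all steps are neighbourhoods of zero are
neighbourhoods of zero in the inductive limit. -/
theorem mem_nhds_zero_inductiveTopology (hsurj : ∀ e : E, ∃ i x, j i x = e) {V : Set E}
    (hc : Convex ℝ V) (hb : Balanced ℂ V) (h0 : (0 : E) ∈ V) (hV : ∀ i, j i ⁻¹' V ∈ 𝓝 (0 : X i)) :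
    V ∈ @nhds E (inductiveTopology j) 0 := by
  have habs : Absorbent ℝ V := by
    rw [absorbent_iff_forall_absorbs_singleton]
    intro e
    obtain ⟨i, x, rfl⟩ := hsurj e
    rw [absorbs_iff_eventually_nhds_zero h0]
    have ht : Tendsto (fun c : ℝ => (c : ℂ) • x) (𝓝 0) (𝓝 0) := by
      have : Continuous fun c : ℝ => (c : ℂ) • x := by fun_prop
      simpa using this.tendsto 0
    filter_upwards [ht (hV i)] with c hc'
    rw [mapsTo_singleton]
    simpa using hc'
  -- The gauge of `V` is bounded by 1 on the preimage of `V` in each step, so its topology is one of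
  -- those whose infimum is the inductive topology.
  let p : Seminorm ℂ E := gaugeSeminorm hb hc habs
  let q : SeminormFamily ℂ E Unit := fun _ => p
  let t : TopologicalSpace E := q.moduleFilterBasis.topology
  have hq : WithSeminorms q := ⟨rfl⟩
  have hle : inductiveTopology j ≤ t := by
    refine sInf_le ⟨hq.topologicalAddGroup, hq.continuousSMul, hq.toLocallyConvexSpace,
      fun i => hq.continuous_of_continuous_comp (j i) fun _ => ?_⟩
    refine Seminorm.continuous' (r := 1) (mem_of_superset (hV i) fun x hx => ?_)
    rw [Seminorm.mem_closedBall, sub_zero]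
    exact gauge_le_one_of_mem hx
  refine nhds_mono hle ?_
  have : IsTopologicalAddGroup E := hq.topologicalAddGroup
  have hball : p.ball 0 1 ∈ 𝓝 (0 : E) := by
    have h := (hq.continuous_seminorm ()).tendsto 0
    filter_upwards [h (Iio_mem_nhds (by simp : (q ()) 0 < 1))] with x hx
    rw [Seminorm.mem_ball, sub_zero]
    exact hx
  refine mem_of_superset hball fun x hx => ?_
  rw [Seminorm.mem_ball, sub_zero] at hx
  exact setOfPred_gauge_lt_one_subset_self hc h0 habs hx

/-- A linear functional on the inductive limit is continuous if it is so on all steps. -/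
theorem continuous_inductiveTopology_dom (T : E →ₗ[ℂ] ℂ) (hT : ∀ i, Continuous (T ∘ₗ j i)) :
    @Continuous E ℂ (inductiveTopology j) _ T := by
  -- The topology induced by `T` is itself one of the competing locally convex topologies.
  refine continuous_iff_le_induced.2 (sInf_le ⟨topologicalAddGroup_induced T,
    continuousSMul_induced T.toMulActionHom, LocallyConvexSpace.induced (T.restrictScalars ℝ),
    fun i => continuous_induced_rng.2 (hT i)⟩)

end InductiveTopology

/-! ### Compact operators between normed spaces. -/

section NormedSpaces

variable {X : Type u} {Y : Type v} [NormedAddCommGroup X] [NormedSpace ℂ X]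
  [NormedAddCommGroup Y] [NormedSpace ℂ Y]

theorem balanced_image {V : Type u} {W : Type v} [AddCommGroup V] [Module ℂ V] [AddCommGroup W]
    [Module ℂ W] {A : Set V} (hA : Balanced ℂ A) (f : V →ₗ[ℂ] W) : Balanced ℂ (f '' A) := by
  rintro c hc _ ⟨_, ⟨x, hx, rfl⟩, rfl⟩
  exact ⟨c • x, hA c hc ⟨x, hx, rfl⟩, map_smul f c x⟩

open scoped Pointwise in
/-- The image of a compact absolutely convex set under a compact operator can be thickened to one
that absorbs the image of a ball and still avoids a given finite set. -/
theorem exists_compact_absConvex_thickening {s : X →L[ℂ] Y} (hs : IsCompactOperator s)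
    (hle : ∀ x, ‖s x‖ ≤ ‖x‖) {A : Set X} (hA : IsCompact A) (hAc : Convex ℝ A)
    (hAb : Balanced ℂ A) (h0 : (0 : X) ∈ A) {r : ℝ} (hr : A ⊆ Metric.closedBall 0 r) {F : Set Y}
    (hF : F.Finite) (hFA : ∀ y ∈ F, y ∉ s '' A) :
    ∃ B : Set Y, IsCompact B ∧ Convex ℝ B ∧ Balanced ℂ B ∧ (0 : Y) ∈ B ∧
      B ⊆ Metric.closedBall 0 (r + 1) ∧ s '' A ⊆ B ∧ (∃ δ > 0, s '' Metric.closedBall 0 δ ⊆ B) ∧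
      ∀ y ∈ F, y ∉ B := by
  have hsA : IsCompact (s '' A) := hA.image s.continuous
  have hsub : ∀ δ, closure (s '' Metric.closedBall 0 δ) ⊆ Metric.closedBall (0 : Y) δ := by
    intro δ
    refine closure_minimal ?_ Metric.isClosed_closedBall
    rintro _ ⟨x, hx, rfl⟩
    rw [mem_closedBall_zero_iff] at hx ⊢
    exact (hle x).trans hx
  -- A point off the compact set `s '' A` has positive distance to it, and adding vectors of norm at
  -- most `δ` cannot bridge that distance for small `δ`.
  have hev : ∀ᶠ δ in 𝓝[>] (0 : ℝ), ∀ y ∈ F,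
      y ∉ s '' A + closure (s '' Metric.closedBall 0 δ) := by
    rw [eventually_all_finite hF]
    intro y hy
    have hpos : 0 < Metric.infDist y (s '' A) := by
      rw [← Metric.infDist_pos_iff_notMem_closure (Set.Nonempty.image s ⟨0, h0⟩),
        hsA.isClosed.closure_eq]
      exact hFA y hy
    filter_upwards [nhdsWithin_le_nhds (Iio_mem_nhds hpos)] with δ hδ hmem
    obtain ⟨a, ha, c, hc, rfl⟩ := hmem
    have h1 := Metric.infDist_le_dist_of_mem (x := a + c) ha
    have h2 := hsub δ hc
    rw [mem_closedBall_zero_iff] at h2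
    rw [dist_eq_norm, add_sub_cancel_left] at h1
    exact absurd (h1.trans h2) (not_le.2 hδ)
  obtain ⟨δ, ⟨hδF, hδ1⟩, hδ0⟩ := ((hev.and (nhdsWithin_le_nhds (Iio_mem_nhds one_pos))).and
    self_mem_nhdsWithin).exists
  have hδ0 : 0 < δ := hδ0
  have hδ1 : δ < 1 := hδ1
  have hc0 : (0 : Y) ∈ closure (s '' Metric.closedBall 0 δ) :=
    subset_closure ⟨0, Metric.mem_closedBall_self hδ0.le, map_zero s⟩
  have hs0 : (0 : Y) ∈ s '' A := ⟨0, h0, map_zero s⟩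
  refine ⟨s '' A + closure (s '' Metric.closedBall 0 δ),
    hsA.add (hs.isCompact_closure_image_closedBall (f := (s : X →ₗ[ℂ] Y)) δ), ?_, ?_, ?_, ?_,
    ?_, ?_, hδF⟩
  · exact (hAc.linear_image ((s : X →ₗ[ℂ] Y).restrictScalars ℝ)).add
      (((convex_closedBall (0 : X) δ).linear_image ((s : X →ₗ[ℂ] Y).restrictScalars ℝ)).closure)
  · refine Balanced.add ?_ (Balanced.closure ?_)
    · exact balanced_image hAb (s : X →ₗ[ℂ] Y)
    · exact balanced_image balanced_closedBall_zero (s : X →ₗ[ℂ] Y)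
  · exact ⟨0, hs0, 0, hc0, add_zero 0⟩
  · rintro _ ⟨_, ⟨a, ha, rfl⟩, c, hc, rfl⟩
    have h1 := mem_closedBall_zero_iff.1 (hr ha)
    have h2 := mem_closedBall_zero_iff.1 (hsub δ hc)
    rw [mem_closedBall_zero_iff]
    exact (norm_add_le _ _).trans (add_le_add ((hle a).trans h1) (h2.trans hδ1.le))
  · exact fun y hy => ⟨y, hy, 0, hc0, add_zero y⟩
  · exact ⟨δ, hδ0, fun y hy => ⟨0, hs0, y, subset_closure hy, zero_add y⟩⟩

/-- A functional composed with a compact operator is approximated in norm by linear combinations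
of any family of functionals that separates points. -/
theorem exists_sum_approx_of_separating {s : X →L[ℂ] Y} (hs : IsCompactOperator s) {ι : Type w}
    (φ : ι → StrongDual ℂ Y) (hφ : ∀ y, (∀ i, φ i y = 0) → y = 0) (T : StrongDual ℂ Y) {ε : ℝ}
    (hε : 0 < ε) :
    ∃ (t : Finset ι) (c : t → ℂ), ∀ x, ‖T (s x) - ∑ i, c i * φ i (s x)‖ ≤ ε * ‖x‖ := by
  -- Zero is not in this compact set, so by separation finitely many `φ i` have no common zero on
  -- it.
  have hcomp : IsCompact (closure (s '' Metric.closedBall 0 1) ∩ {y | ε ≤ ‖T y‖}) :=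
    (hs.isCompact_closure_image_closedBall (f := (s : X →ₗ[ℂ] Y)) 1).inter_right
      (isClosed_le continuous_const (by fun_prop))
  obtain ⟨t, ht⟩ := hcomp.elim_finite_subcover (fun i => {y | φ i y ≠ 0})
    (fun i => isOpen_ne_fun (φ i).continuous continuous_const) (by
      rintro y ⟨-, hy⟩
      by_contra hcon
      simp only [mem_iUnion, not_exists] at hcon
      have : y = 0 := hφ y fun i => by simpa using hcon i
      rw [this] at hy
      simp only [mem_ofPred_eq, map_zero, norm_zero] at hy
      exact absurd hy (not_le.2 hε))
  have hsmall : ∀ x : X, ‖x‖ ≤ 1 → (∀ i : t, φ i (s x) = 0) → ‖T (s x)‖ ≤ ε := by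
    intro x hx hi
    by_contra hcon
    have hmem := ht ⟨subset_closure ⟨x, mem_closedBall_zero_iff.2 hx, rfl⟩, (not_le.1 hcon).le⟩
    simp only [mem_iUnion] at hmem
    obtain ⟨i, hit, hne⟩ := hmem
    exact hne (hi ⟨i, hit⟩)
  let L : t → X →ₗ[ℂ] ℂ := fun i => ((φ i).comp s : X →L[ℂ] ℂ)
  let p : Submodule ℂ X := ⨅ i, LinearMap.ker (L i)
  have hp : ∀ x ∈ p, ∀ i : t, φ i (s x) = 0 := by
    intro x hx i
    exact LinearMap.mem_ker.1 ((Submodule.mem_iInf _).1 hx i)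
  -- On the common kernel `p`, `T ∘ s` has norm at most `ε`. Its Hahn–Banach extension `g` is the
  -- error term: `T ∘ s - g` vanishes on `p`, hence is a combination of the `L i`.
  let T₀ : StrongDual ℂ p := (T.comp s).comp p.subtypeL
  have hT₀ : ‖T₀‖ ≤ ε := by
    refine ContinuousLinearMap.opNorm_le_of_unit_norm (𝕜 := ℝ) (f := T₀.restrictScalars ℝ)
      hε.le fun x hx => ?_
    exact hsmall x (by simpa using hx.le) (hp x x.2)
  obtain ⟨g, hg, hgn⟩ := exists_extension_norm_eq p T₀
  have hker : ⨅ i, LinearMap.ker (L i) ≤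
      LinearMap.ker ((T.comp s - g : X →L[ℂ] ℂ) : X →ₗ[ℂ] ℂ) := by
    intro x hx
    have := hg ⟨x, hx⟩
    rw [LinearMap.mem_ker]
    change T (s x) - g x = 0
    rw [sub_eq_zero]
    exact this.symm
  obtain ⟨c, hc⟩ :=
    (Submodule.mem_span_range_iff_exists_fun ℂ).1 (mem_span_of_iInf_ker_le_ker hker)
  refine ⟨t, c, fun x => ?_⟩
  have h1 : ∑ i, c i * φ i (s x) = T (s x) - g x := by
    have := LinearMap.congr_fun hc x
    simpa [L, LinearMap.sum_apply] using this
  rw [h1, sub_sub_cancel]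
  exact (g.le_opNorm x).trans (mul_le_mul_of_nonneg_right (hgn.trans_le hT₀) (norm_nonneg x))

end NormedSpaces

/-! ### Unions of sequences of normed spaces with compact linking maps. -/

/-- The maps `j k : X k → E` exhibit the vector space `E` as the union of the sequence
`X 0 → X 1 → ⋯` of normed spaces with compact contractive linking maps `s k`. -/
structure IsCompactUnion {X : ℕ → Type v} {E : Type w}
    [∀ k, NormedAddCommGroup (X k)] [∀ k, NormedSpace ℂ (X k)]
    [AddCommGroup E] [Module ℂ E] (s : ∀ k, X k →L[ℂ] X (k + 1)) (j : ∀ k, X k →ₗ[ℂ] E) :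
    Prop where
  compact : ∀ k, IsCompactOperator (s k)
  norm_le : ∀ k x, ‖s k x‖ ≤ ‖x‖
  comp : ∀ k x, j (k + 1) (s k x) = j k x
  injective : ∀ k, Function.Injective (j k)
  exists_eq : ∀ e : E, ∃ k x, j k x = e

namespace IsCompactUnion

variable {X : ℕ → Type v} {E : Type w} [∀ k, NormedAddCommGroup (X k)] [∀ k, NormedSpace ℂ (X k)]
  [AddCommGroup E] [Module ℂ E] {s : ∀ k, X k →L[ℂ] X (k + 1)} {j : ∀ k, X k →ₗ[ℂ] E}

/-- Given points `y k` outside the image of the ball of radius `k` in `X k`, there is a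
neighbourhood of zero in the inductive limit that contains none of them. -/
theorem exists_nhds_avoiding (h : IsCompactUnion s j) (y : ℕ → E)
    (hy : ∀ k : ℕ, y k ∉ j k '' Metric.closedBall 0 k) :
    ∃ V ∈ @nhds E (inductiveTopology j) 0, ∀ k, y k ∉ V := by
  -- The radius bound is what excludes the new point `y (k + 1)` at the next stage; the earlier
  -- points are finitely many and are avoided by a small enough thickening.
  let P : ∀ k, Set (X k) → Prop := fun k A => IsCompact A ∧ Convex ℝ A ∧ Balanced ℂ A ∧
    (0 : X k) ∈ A ∧ A ⊆ Metric.closedBall 0 (k : ℝ) ∧ ∀ i ≤ k, y i ∉ j k '' A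
  have hstep : ∀ k (A : {A // P k A}), ∃ B : {B // P (k + 1) B},
      s k '' A.1 ⊆ B.1 ∧ ∃ δ > 0, s k '' Metric.closedBall 0 δ ⊆ B.1 := by
    rintro k ⟨A, hA, hAc, hAb, h0, hr, hyA⟩
    let F : Set (X (k + 1)) := j (k + 1) ⁻¹' (y '' Iic k)
    have hF : F.Finite := ((finite_Iic k).image y).preimage (h.injective _).injOn
    obtain ⟨B, hB1, hB2, hB3, hB4, hB5, hB6, hB7, hB8⟩ :=
      exists_compact_absConvex_thickening (h.compact k) (h.norm_le k) hA hAc hAb h0 hr hF (by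
        rintro _ ⟨i, hi, hiy⟩ ⟨a, ha, rfl⟩
        exact hyA i hi ⟨a, ha, by rw [hiy, h.comp]⟩)
    refine ⟨⟨B, hB1, hB2, hB3, hB4, by exact_mod_cast hB5, fun i hi => ?_⟩, hB6, hB7⟩
    rintro ⟨b, hb, hby⟩
    rcases Nat.le_succ_iff.1 hi with hi | rfl
    · exact hB8 b ⟨i, hi, hby.symm⟩ hb
    · exact hy _ ⟨b, by exact_mod_cast hB5 hb, hby⟩
  choose f hf using hstep
  -- The ball of radius 0 is `{0}`, so the hypothesis at `k = 0` says `y 0 ≠ 0`.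
  let A₀ : {A // P 0 A} := ⟨{0}, isCompact_singleton, convex_singleton 0, by
    exact balanced_zero, rfl, by simp, fun i hi => by
      obtain rfl : i = 0 := Nat.le_zero.1 hi
      simpa using hy 0⟩
  let A : ∀ k, {A // P k A} := fun k => Nat.rec (motive := fun k => {A // P k A}) A₀ f k
  have hAs : ∀ k, A (k + 1) = f k (A k) := fun _ => rfl
  let V : Set E := ⋃ k, j k '' (A k).1
  have hmono : Monotone fun k => j k '' (A k).1 := by
    refine monotone_nat_of_le_succ fun k => ?_
    rintro _ ⟨a, ha, rfl⟩
    exact ⟨s k a, (hf k (A k)).1 ⟨a, ha, rfl⟩, h.comp k a⟩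
  refine ⟨V, mem_nhds_zero_inductiveTopology h.exists_eq ?_ ?_ ?_ fun k => ?_, fun k hk => ?_⟩
  · exact hmono.directed_le.convex_iUnion fun k =>
      (A k).2.2.1.linear_image ((j k).restrictScalars ℝ)
  · refine balanced_iUnion fun k => ?_
    have hbal : Balanced ℂ (A k).1 := (A k).2.2.2.1
    exact balanced_image hbal (j k)
  · exact mem_iUnion.2 ⟨0, 0, (A 0).2.2.2.2.1, map_zero _⟩
  · obtain ⟨δ, hδ, hsub⟩ := (hf k (A k)).2
    refine mem_of_superset (Metric.closedBall_mem_nhds 0 hδ) fun x hx => ?_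
    exact mem_iUnion.2 ⟨k + 1, s k x, hsub ⟨x, hx, rfl⟩, h.comp k x⟩
  · obtain ⟨m, hm⟩ := mem_iUnion.1 hk
    have h1 := hmono (le_max_left m k) hm
    exact (A (max m k)).2.2.2.2.2.2 k (le_max_right m k) h1

variable [t : TopologicalSpace E]

/-- Bounded sets of the inductive limit are contained and bounded in a step. -/
theorem exists_subset_image_closedBall (h : IsCompactUnion s j) (ht : t = inductiveTopology j)
    {B : Set E} (hB : Bornology.IsVonNBounded ℂ B) : ∃ k R, B ⊆ j k '' Metric.closedBall 0 R := by
  by_contra hcon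
  push Not at hcon
  -- If `B` is in no ball of any step, scaled points of `B` escape the ball of radius `k` in step
  -- `k`. A zero neighbourhood missing them all contradicts boundedness, as the scalars tend to 0.
  have hex : ∀ k : ℕ, ∃ b ∈ B, (1 / ((k : ℂ) + 1)) • b ∉ j k '' Metric.closedBall 0 k := by
    intro k
    obtain ⟨b, hb, hbn⟩ := not_subset.1 (hcon k ((k + 1) * k))
    refine ⟨b, hb, ?_⟩
    rintro ⟨x, hx, hxb⟩
    have hk : ((k : ℂ) + 1) ≠ 0 := Nat.cast_add_one_ne_zero k
    refine hbn ⟨((k : ℂ) + 1) • x, ?_, ?_⟩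
    · rw [mem_closedBall_zero_iff] at hx ⊢
      rw [norm_smul]
      have : ‖(k : ℂ) + 1‖ = k + 1 := by
        rw [← Nat.cast_add_one, Complex.norm_natCast, Nat.cast_add_one]
      rw [this]
      gcongr
    · rw [map_smul, hxb, smul_smul, mul_one_div_cancel hk, one_smul]
  choose b hbB hb using hex
  obtain ⟨V, hV, hyV⟩ := h.exists_nhds_avoiding _ hb
  rw [← ht] at hV
  have hev := (hB hV).eventually_nhds_zero (mem_of_mem_nhds hV)
  obtain ⟨k, hk⟩ := ((tendsto_one_div_add_atTop_nhds_zero_nat (𝕜 := ℂ)).eventually hev).exists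
  exact hyV k (hk (hbB k))

/-- The inductive limit is Hausdorff. -/
theorem t2Space (h : IsCompactUnion s j) (ht : t = inductiveTopology j) : T2Space E := by
  have hg : IsTopologicalAddGroup E := by
    rw [ht]; exact inductiveTopology_isTopologicalAddGroup j
  have hsm : ContinuousSMul ℂ E := by
    rw [ht]; exact inductiveTopology_continuousSMul j
  refine IsTopologicalAddGroup.t2Space_of_zero_sep fun e he => ?_
  by_contra hcon
  push Not at hcon
  -- A nonzero `e` in every zero neighbourhood would make its whole line bounded, yet a line is not
  -- bounded in any step.
  have hB : Bornology.IsVonNBounded ℂ (range fun c : ℂ => c • e) := by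
    intro V hV
    have : range (fun c : ℂ => c • e) ⊆ V := by
      rintro _ ⟨c, rfl⟩
      have h1 : Tendsto (fun x : E => c • x) (𝓝 0) (𝓝 0) := by
        simpa using (continuous_const_smul c).tendsto (0 : E)
      exact hcon _ (h1 hV)
    have hsc : ∀ᶠ c in Bornology.cobounded ℂ, c ≠ 0 := Bornology.eventually_ne_cobounded 0
    filter_upwards [hsc] with c hc
    rintro _ ⟨d, rfl⟩
    refine ⟨(c⁻¹ * d) • e, this ⟨_, rfl⟩, ?_⟩
    change c • (c⁻¹ * d) • e = d • e
    rw [smul_smul, mul_inv_cancel_left₀ hc]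
  obtain ⟨k, R, hR⟩ := h.exists_subset_image_closedBall ht hB
  obtain ⟨x, -, hx⟩ := hR ⟨1, rfl⟩
  have hx : j k x = e := by simpa using hx
  have hx0 : x ≠ 0 := fun h0 => he (by rw [← hx, h0, map_zero])
  obtain ⟨n, hn⟩ := exists_nat_gt (R / ‖x‖)
  obtain ⟨z, hz, hzn⟩ := hR ⟨(n : ℂ), rfl⟩
  have hzx : z = (n : ℂ) • x := h.injective k (by rw [hzn, map_smul, hx])
  rw [hzx, mem_closedBall_zero_iff, norm_smul, Complex.norm_natCast] at hz
  rw [div_lt_iff₀ (norm_pos_iff.2 hx0)] at hn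
  exact absurd hz (not_le.2 hn)

/-- Sets of continuous functionals that separate points span dense subspaces of the strong
dual. -/
theorem dense_span_of_separating (h : IsCompactUnion s j) (ht : t = inductiveTopology j)
    (S : Set (StrongDual ℂ E)) (hS : ∀ e, (∀ T ∈ S, T e = 0) → e = 0) :
    Dense (Submodule.span ℂ S : Set (StrongDual ℂ E)) := by
  have hj : ∀ k, Continuous (j k) := fun k => by
    rw [ht]; exact continuous_inductiveTopology j k
  intro T
  rw [mem_closure_iff_nhds]
  intro N hN
  have hadd : Tendsto (fun f : StrongDual ℂ E => T + f) (𝓝 0) (𝓝 T) := by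
    simpa using (continuous_const_add T).tendsto (0 : StrongDual ℂ E)
  obtain ⟨⟨B, ε⟩, ⟨hB, hε⟩, hsub⟩ :=
    (ContinuousLinearMap.hasBasis_nhds_zero_of_basis Metric.nhds_basis_ball).mem_iff.1 (hadd hN)
  obtain ⟨k, R, hR⟩ := h.exists_subset_image_closedBall ht hB
  let J : X (k + 1) →L[ℂ] E := ⟨j (k + 1), hj (k + 1)⟩
  have hJ : ∀ x, J (s k x) = j k x := h.comp k
  -- `R` may be zero or negative.
  have hR0 : 0 < |R| + 1 := by positivity
  obtain ⟨c, a, hca⟩ := exists_sum_approx_of_separating (h.compact k)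
    (fun T : S => (T : StrongDual ℂ E).comp J) (fun y hy => by
      refine h.injective (k + 1) ?_
      rw [map_zero]
      exact hS _ fun T hT => hy ⟨T, hT⟩) (T.comp J) (div_pos hε hR0)
  have hmem : ∑ i, a i • (i.1 : StrongDual ℂ E) ∈ Submodule.span ℂ S :=
    Submodule.sum_mem _ fun i _ => Submodule.smul_mem _ _ (Submodule.subset_span i.1.2)
  refine ⟨∑ i, a i • (i.1 : StrongDual ℂ E), ?_, hmem⟩
  have hin : (∑ i, a i • (i.1 : StrongDual ℂ E)) - T ∈
      {f : StrongDual ℂ E | ∀ x ∈ B, f x ∈ Metric.ball (0 : ℂ) ε} := by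
    intro x hx
    obtain ⟨z, hz, rfl⟩ := hR hx
    have h1 := hca z
    simp only [ContinuousLinearMap.comp_apply, hJ] at h1
    rw [mem_ball_zero_iff, sub_apply, norm_sub_rev,
      sum_apply]
    simp only [smul_apply, smul_eq_mul]
    refine h1.trans_lt ?_
    rw [div_mul_eq_mul_div, div_lt_iff₀ hR0]
    have hz' := mem_closedBall_zero_iff.1 hz
    have : ‖z‖ < |R| + 1 := (hz'.trans (le_abs_self R)).trans_lt (lt_add_one _)
    gcongr
  simpa using hsub hin

end IsCompactUnion

/-! ### The neighbourhoods `U_t(K)` -/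

section Neighbourhoods

variable {K : Set EReal}

theorem isOpen_U (K : Set EReal) (t : ℝ) : IsOpen (U K t) := by
  refine (Metric.isOpen_thickening.union ?_).union ?_
  · refine isOpen_const.inter (IsOpen.inter ?_ ?_)
    · exact isOpen_lt continuous_const Complex.continuous_re
    · exact isOpen_lt Complex.continuous_im.abs continuous_const
  · refine isOpen_const.inter (IsOpen.inter ?_ ?_)
    · exact isOpen_lt Complex.continuous_re continuous_const
    · exact isOpen_lt Complex.continuous_im.abs continuous_const

/-- The strict margin lets compact subsets of the smaller closure be treated as lying in the open
set where functions of an earlier step are holomorphic. -/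
theorem closure_U_subset (K : Set EReal) {s t : ℝ} (hs : 0 < s) (h : s < t) :
    closure (U K t) ⊆ U K s := by
  have h1 : 1 / t < 1 / s := one_div_lt_one_div_of_lt hs h
  rw [U, closure_union, closure_union]
  rintro z ((hz | hz) | hz)
  · exact Or.inl (Or.inl (Metric.cthickening_subset_thickening' (one_div_pos.2 hs) h1 _
      (Metric.closure_thickening_subset_cthickening _ _ hz)))
  · have hcl : IsClosed {z : ℂ | (⊤ : EReal) ∈ K ∧ t ≤ z.re ∧ |z.im| ≤ 1 / t} := by
      refine isClosed_const.inter (IsClosed.inter ?_ ?_)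
      · exact isClosed_le continuous_const Complex.continuous_re
      · exact isClosed_le Complex.continuous_im.abs continuous_const
    have hz' := hcl.closure_subset_iff.2 (fun w hw => ⟨hw.1, hw.2.1.le, hw.2.2.le⟩) hz
    exact Or.inl (Or.inr ⟨hz'.1, h.trans_le hz'.2.1, hz'.2.2.trans_lt h1⟩)
  · have hcl : IsClosed {z : ℂ | (⊥ : EReal) ∈ K ∧ z.re ≤ -t ∧ |z.im| ≤ 1 / t} := by
      refine isClosed_const.inter (IsClosed.inter ?_ ?_)
      · exact isClosed_le Complex.continuous_re continuous_const
      · exact isClosed_le Complex.continuous_im.abs continuous_const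
    have hz' := hcl.closure_subset_iff.2 (fun w hw => ⟨hw.1, hw.2.1.le, hw.2.2.le⟩) hz
    exact Or.inr ⟨hz'.1, hz'.2.1.trans_lt (neg_lt_neg h), hz'.2.2.trans_lt h1⟩

theorem closure_U_subset_pnat (K : Set EReal) {n k : ℕ+} (h : n < k) :
    closure (U K k) ⊆ U K n :=
  closure_U_subset K (by exact_mod_cast n.pos) (by exact_mod_cast h)

theorem ball_subset_U {x : ℝ} (hx : (x : EReal) ∈ K) (t : ℝ) :
    Metric.ball (x : ℂ) (1 / t) ⊆ U K t := fun _ hz =>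
  Or.inl (Or.inl (Metric.mem_thickening_iff.2 ⟨x, ⟨x, hx, rfl⟩, hz⟩))

theorem ofReal_mem_U {x : ℝ} (hx : (x : EReal) ∈ K) {t : ℝ} (ht : 0 < t) : (x : ℂ) ∈ U K t :=
  ball_subset_U hx t (Metric.mem_ball_self (one_div_pos.2 ht))

theorem isPreconnected_strip_right (t r : ℝ) :
    IsPreconnected {z : ℂ | t < z.re ∧ |z.im| < r} := by
  have h : {z : ℂ | t < z.re ∧ |z.im| < r} =
      {z | t < z.re} ∩ ({z | -r < z.im} ∩ {z | z.im < r}) := by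
    ext z; simp [abs_lt]
  rw [h]
  exact ((convex_halfSpace_re_gt t).inter
    ((convex_halfSpace_im_gt (-r)).inter (convex_halfSpace_im_lt r))).isPreconnected

theorem isPreconnected_strip_left (t r : ℝ) :
    IsPreconnected {z : ℂ | z.re < t ∧ |z.im| < r} := by
  have h : {z : ℂ | z.re < t ∧ |z.im| < r} =
      {z | z.re < t} ∩ ({z | -r < z.im} ∩ {z | z.im < r}) := by
    ext z; simp [abs_lt]
  rw [h]
  exact ((convex_halfSpace_re_lt t).inter
    ((convex_halfSpace_im_gt (-r)).inter (convex_halfSpace_im_lt r))).isPreconnected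

/-- A point of `K` near `⊤` but different from it is real; it will lie in the half-strip and start
the identity theorem there. -/
theorem exists_real_gt_of_accPt_top (h : AccPt (⊤ : EReal) (𝓟 K)) (t : ℝ) :
    ∃ x : ℝ, (x : EReal) ∈ K ∧ t < x := by
  obtain ⟨y, ⟨hne, hy⟩, hty⟩ := ((accPt_iff_frequently.1 h).and_eventually
    (Ioi_mem_nhds (EReal.coe_lt_top t))).exists
  have hty : (t : EReal) < y := hty
  lift y to ℝ using ⟨hne, (bot_lt_of_lt hty).ne'⟩
  exact ⟨y, hy, EReal.coe_lt_coe_iff.1 hty⟩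

theorem exists_real_lt_of_accPt_bot (h : AccPt (⊥ : EReal) (𝓟 K)) (t : ℝ) :
    ∃ x : ℝ, (x : EReal) ∈ K ∧ x < t := by
  obtain ⟨y, ⟨hne, hy⟩, hty⟩ := ((accPt_iff_frequently.1 h).and_eventually
    (Iio_mem_nhds (EReal.bot_lt_coe t))).exists
  have hty : y < (t : EReal) := hty
  lift y to ℝ using ⟨(lt_top_of_lt hty).ne, hne⟩
  exact ⟨y, hy, EReal.coe_lt_coe_iff.1 hty⟩

theorem frequently_mem_of_accPt {x : ℝ} (h : AccPt (x : EReal) (𝓟 K)) :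
    ∃ᶠ z : ℂ in 𝓝[≠] (x : ℂ), ∃ y : ℝ, (y : EReal) ∈ K ∧ z = y := by
  have h1 := accPt_iff_frequently.1 h
  rw [EReal.nhds_coe, frequently_map] at h1
  have ht : Tendsto (fun y : ℝ => (y : ℂ)) (𝓝 x) (𝓝 (x : ℂ)) := Complex.continuous_ofReal.tendsto x
  rw [frequently_nhdsWithin_iff]
  refine ht.frequently (h1.mono fun y hy => ⟨⟨y, hy.2, rfl⟩, ?_⟩)
  exact fun hyx => hy.1 (by rw [Complex.ofReal_injective hyx])

end Neighbourhoods

/-! ### The steps -/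

namespace OSpace

variable {ν : Weights} {K : Set EReal} {n : ℕ+}

/-- No restriction on `z` is needed because functions are extended by zero. -/
theorem norm_apply_le (f : OSpace ν K n) (z : ℂ) : ‖f z‖ ≤ ν n z * ‖f‖ := by
  by_cases hz : z ∈ closure (U K n)
  · have h := le_norm f hz
    rwa [← div_eq_mul_inv, div_le_iff₀ (ν.pos' n z), mul_comm] at h
  · rw [f.2.2.2.2 z hz, norm_zero]
    exact mul_nonneg (ν.pos' n z).le (norm_nonneg f)

theorem norm_le_of_norm_apply_le {f : OSpace ν K n} {C : ℝ} (h0 : 0 ≤ C)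
    (h : ∀ z ∈ closure (U K n), ‖f z‖ ≤ C * ν n z) : ‖f‖ ≤ C :=
  norm_le h0 fun z hz => by
    rw [← div_eq_mul_inv, div_le_iff₀ (ν.pos' n z)]
    exact h z hz

theorem analyticOnNhd (f : OSpace ν K n) : AnalyticOnNhd ℂ f (U K n) :=
  f.2.1.analyticOnNhd (isOpen_U K n)

instance : CompleteSpace (OSpace ν K n) := by
  refine Metric.complete_of_cauchySeq_tendsto fun u hu => ?_
  have hdist : ∀ k l z, dist (u k z) (u l z) ≤ ν n z * dist (u k) (u l) := fun k l z => by
    rw [dist_eq_norm, dist_eq_norm]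
    exact norm_apply_le (u k - u l) z
  have hlim : ∀ z, ∃ w, Tendsto (fun k => u k z) atTop (𝓝 w) := fun z => by
    refine cauchySeq_tendsto_of_complete (Metric.cauchySeq_iff'.2 fun ε hε => ?_)
    obtain ⟨N, hN⟩ := Metric.cauchySeq_iff'.1 hu (ε / ν n z) (div_pos hε (ν.pos' n z))
    refine ⟨N, fun k hk => (hdist k N z).trans_lt ?_⟩
    have := hN k hk
    rwa [lt_div_iff₀ (ν.pos' n z), mul_comm] at this
  choose F hF using hlim
  have hunif : ∀ ε > 0, ∃ N, ∀ k ≥ N, ∀ z, dist (u k z) (F z) ≤ ε * ν n z := fun ε hε => by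
    obtain ⟨N, hN⟩ := Metric.cauchySeq_iff.1 hu ε hε
    refine ⟨N, fun k hk z => ?_⟩
    refine le_of_tendsto (tendsto_const_nhds.dist (hF z)) ?_
    filter_upwards [eventually_ge_atTop N] with l hl
    rw [mul_comm]
    exact (hdist k l z).trans (mul_le_mul_of_nonneg_left (hN k hk l hl).le (ν.pos' n z).le)
  have hloc : ∀ s : Set ℂ, TendstoLocallyUniformlyOn (fun k => (u k : ℂ → ℂ)) F atTop s := by
    intro s
    refine Metric.tendstoLocallyUniformlyOn_iff.2 fun ε hε x _ => ?_
    have hx : 0 < ν n x + 1 := by linarith [ν.pos' n x]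
    -- Weighted uniform convergence becomes uniform where the weight is bounded.
    refine ⟨{y | ν n y < ν n x + 1}, mem_nhdsWithin_of_mem_nhds
      ((ν.continuous' n).continuousAt.eventually_lt_const (lt_add_one _)), ?_⟩
    obtain ⟨N, hN⟩ := hunif (ε / (ν n x + 1)) (div_pos hε hx)
    filter_upwards [eventually_ge_atTop N] with k hk y hy
    rw [dist_comm]
    refine (hN k hk y).trans_lt ?_
    rw [div_mul_eq_mul_div, div_lt_iff₀ hx]
    exact mul_lt_mul_of_pos_left hy hε
  have hmem : F ∈ OSubmodule ν K n := by
    refine ⟨(hloc _).differentiableOn (Eventually.of_forall fun k => (u k).2.1) (isOpen_U K n),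
      (hloc _).continuousOn (Frequently.of_forall fun k => (u k).2.2.1), ?_, fun z hz => ?_⟩
    · obtain ⟨N, hN⟩ := hunif 1 one_pos
      refine ⟨1 + ‖u N‖, fun z _ => ?_⟩
      rw [← div_eq_mul_inv, div_le_iff₀ (ν.pos' n z)]
      have h1 := hN N le_rfl z
      have h2 := norm_apply_le (u N) z
      rw [dist_comm, dist_eq_norm] at h1
      have h3 := norm_add_le (F z - u N z) (u N z)
      rw [sub_add_cancel] at h3
      linarith
    · exact tendsto_nhds_unique (hF z) (by simp [fun k => (u k).2.2.2.2 z hz])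
  let G : OSpace ν K n := ⟨F, hmem⟩
  refine ⟨G, Metric.tendsto_atTop'.2 fun ε hε => ?_⟩
  obtain ⟨N, hN⟩ := hunif (ε / 2) (half_pos hε)
  refine ⟨N, fun k hk => ?_⟩
  rw [dist_eq_norm]
  refine (norm_le_of_norm_apply_le (half_pos hε).le fun z _ => ?_).trans_lt (half_lt_self hε)
  have := hN k (le_of_lt hk) z
  rwa [dist_eq_norm] at this

/-- Uniform bounds near points of `U_n(K)`. -/
theorem exists_closedBall_bound {x : ℂ} (hx : x ∈ U K n) :
    ∃ r > 0, Metric.closedBall x r ⊆ U K n ∧ ∃ M > 0, ∀ (f : OSpace ν K n),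
      ∀ z ∈ Metric.closedBall x r, ‖f z‖ ≤ M * ‖f‖ := by
  obtain ⟨r, hr, hsub⟩ := Metric.nhds_basis_closedBall.mem_iff.1 ((isOpen_U K n).mem_nhds hx)
  obtain ⟨M, hM⟩ := (isCompact_closedBall x r).exists_bound_of_continuousOn
    (ν.continuous' n).continuousOn
  refine ⟨r, hr, hsub, M, ?_, fun f z hz => ?_⟩
  · have := hM x (Metric.mem_closedBall_self hr.le)
    rw [Real.norm_of_nonneg (ν.pos' n x).le] at this
    exact (ν.pos' n x).trans_le this
  · have := hM z hz
    rw [Real.norm_of_nonneg (ν.pos' n z).le] at this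
    exact (norm_apply_le f z).trans (mul_le_mul_of_nonneg_right this (norm_nonneg f))

/-- Equicontinuity of the unit ball at `x`, from the Schwarz lemma: the ball is mapped into the disc
of radius `2 * M` about `f x`. -/
theorem exists_dist_le {x : ℂ} (hx : x ∈ U K n) : ∃ r > 0, ∃ L > 0, ∀ f : OSpace ν K n,
    ‖f‖ ≤ 1 → ∀ z ∈ Metric.ball x r, dist (f z) (f x) ≤ L * dist z x := by
  obtain ⟨r, hr, hsub, M, hM, hf⟩ := exists_closedBall_bound (ν := ν) hx
  have hM1 : ∀ f : OSpace ν K n, ‖f‖ ≤ 1 → ∀ z ∈ Metric.closedBall x r, ‖f z‖ ≤ M :=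
    fun f h1 z hz => (hf f z hz).trans (mul_le_of_le_one_right hM.le h1)
  refine ⟨r, hr, 2 * M / r, by positivity, fun f h1 z hz => ?_⟩
  refine Complex.dist_le_div_mul_dist_of_mapsTo_ball
    (f.2.1.mono (Metric.ball_subset_closedBall.trans hsub)) (fun w hw => ?_) hz
  rw [Metric.mem_closedBall, dist_eq_norm]
  have h2 := hM1 f h1 w (Metric.ball_subset_closedBall hw)
  have h3 := hM1 f h1 x (Metric.mem_closedBall_self hr.le)
  exact (norm_sub_le _ _).trans (by linarith)

/-- Cauchy's estimate; it gives continuity of the derivative evaluations on each step. -/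
theorem exists_iteratedDeriv_bound {x : ℂ} (hx : x ∈ U K n) (m : ℕ) :
    ∃ C, ∀ f : OSpace ν K n, ‖iteratedDeriv m f x‖ ≤ C * ‖f‖ := by
  obtain ⟨r, hr, hsub, M, hM, hf⟩ := exists_closedBall_bound (ν := ν) hx
  refine ⟨m.factorial * M / r ^ m, fun f => ?_⟩
  have hcl : DiffContOnCl ℂ f (Metric.ball x r) :=
    DifferentiableOn.diffContOnCl (f.2.1.mono (Metric.closure_ball_subset_closedBall.trans hsub))
  refine (Complex.norm_iteratedDeriv_le_of_forall_mem_sphere_norm_le m hr hcl fun z hz =>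
    hf f z (Metric.sphere_subset_closedBall hz)).trans_eq ?_
  ring

/-- On a compact subset of `U_n(K)`, the unit ball of the step is totally bounded for uniform
convergence. -/
theorem exists_finite_approx {Q : Set ℂ} (hQ : IsCompact Q) (hQU : Q ⊆ U K n) {ε : ℝ}
    (hε : 0 < ε) : ∃ t : Set (OSpace ν K n), t.Finite ∧ (∀ g ∈ t, ‖g‖ ≤ 1) ∧
      ∀ f : OSpace ν K n, ‖f‖ ≤ 1 → ∃ g ∈ t, ∀ z ∈ Q, ‖f z - g z‖ < ε := by
  have : CompactSpace Q := isCompact_iff_compactSpace.1 hQ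
  let Φ : OSpace ν K n → BoundedContinuousFunction Q ℂ := fun f =>
    BoundedContinuousFunction.mkOfCompact ⟨fun z : Q => f z,
      (f.2.1.continuousOn.mono hQU).domRestrict⟩
  obtain ⟨M, hM⟩ := hQ.exists_bound_of_continuousOn (ν.continuous' n).continuousOn
  have hcomp : IsCompact (closure (Φ '' {f | ‖f‖ ≤ 1})) := by
    refine BoundedContinuousFunction.arzela_ascoli _ (isCompact_closedBall (0 : ℂ) M) _ ?_ ?_
    · rintro _ z ⟨f, hf, rfl⟩
      rw [mem_closedBall_zero_iff]
      have h1 := hM z z.2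
      rw [Real.norm_of_nonneg (ν.pos' n z).le] at h1
      exact (norm_apply_le f z).trans
        ((mul_le_of_le_one_right (ν.pos' n z).le hf).trans h1)
    · intro x
      refine Metric.equicontinuousAt_iff.2 fun δ hδ => ?_
      obtain ⟨r, hr, L, hL, hf⟩ := exists_dist_le (ν := ν) (hQU x.2)
      refine ⟨min r (δ / L), lt_min hr (div_pos hδ hL), ?_⟩
      rintro y hy ⟨_, f, hf1, rfl⟩
      have h1 : dist (f y) (f x) ≤ L * dist (y : ℂ) x :=
        hf f hf1 y (Metric.mem_ball.2 (hy.trans_le (min_le_left _ _)))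
      have h2 : dist (y : ℂ) x < δ / L := hy.trans_le (min_le_right _ _)
      rw [lt_div_iff₀ hL, mul_comm] at h2
      change dist (f x) (f y) < δ
      rw [dist_comm]
      exact h1.trans_lt h2
  -- The centres are taken in the image of the unit ball itself, so they come from functions of norm
  -- at most 1.
  obtain ⟨t, ht, htf, hcov⟩ := exists_subset_image_finite_and.1
    (Metric.finite_approx_of_totallyBounded (hcomp.totallyBounded.subset subset_closure) ε hε)
  refine ⟨t, htf, fun g hg => ht hg, fun f hf => ?_⟩
  obtain ⟨_, ⟨g, hg, rfl⟩, hfg⟩ := mem_iUnion₂.1 (hcov ⟨f, hf, rfl⟩)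
  refine ⟨g, hg, fun z hz => ?_⟩
  rw [← dist_eq_norm]
  exact (BoundedContinuousFunction.dist_coe_le_dist (f := Φ f) (g := Φ g) ⟨z, hz⟩).trans_lt hfg

/-- The identity theorem for the functions of a step: it suffices to vanish near the points of `K`
and somewhere on the half-strips. -/
theorem eq_zero_of_eventuallyEq {f : OSpace ν K n}
    (hx : ∀ x : ℝ, (x : EReal) ∈ K → f =ᶠ[𝓝 (x : ℂ)] (0 : ℂ → ℂ))
    (htop : (⊤ : EReal) ∈ K → ∃ x : ℝ, n < x ∧ f =ᶠ[𝓝 (x : ℂ)] (0 : ℂ → ℂ))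
    (hbot : (⊥ : EReal) ∈ K → ∃ x : ℝ, x < -n ∧ f =ᶠ[𝓝 (x : ℂ)] (0 : ℂ → ℂ)) : f = 0 := by
  have hn : (0 : ℝ) < 1 / (n : ℝ) := one_div_pos.2 (by exact_mod_cast n.pos)
  -- `U K n` need not be connected, so the identity theorem is applied separately on each ball and
  -- half-strip, all convex.
  have hU : EqOn f (0 : ℂ → ℂ) (U K n) := by
    rintro z ((hz | hz) | hz)
    · obtain ⟨_, ⟨x, hxK, rfl⟩, hzx⟩ := Metric.mem_thickening_iff.1 hz
      exact (f.analyticOnNhd.mono (ball_subset_U hxK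
        n)).eqOn_zero_of_preconnected_of_eventuallyEq_zero
        (convex_ball (x : ℂ) _).isPreconnected (Metric.mem_ball_self hn) (hx x hxK) hzx
    · obtain ⟨x, hxn, hfx⟩ := htop hz.1
      exact (f.analyticOnNhd.mono fun w hw => Or.inl
        (Or.inr ⟨hz.1, hw⟩)).eqOn_zero_of_preconnected_of_eventuallyEq_zero
        (isPreconnected_strip_right n (1 / n))
        (z₀ := (x : ℂ)) ⟨by simpa using hxn, by simp⟩ hfx hz.2
    · obtain ⟨x, hxn, hfx⟩ := hbot hz.1
      exact (f.analyticOnNhd.mono fun w hw =>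
        Or.inr ⟨hz.1, hw⟩).eqOn_zero_of_preconnected_of_eventuallyEq_zero
        (isPreconnected_strip_left (-n) (1 / n))
        (z₀ := (x : ℂ)) ⟨by simpa using hxn, by simp⟩ hfx hz.2
  refine Subtype.ext (funext fun z => ?_)
  by_cases hz : z ∈ closure (U K n)
  · exact hU.of_subset_closure f.2.2.1 continuousOn_const subset_closure Subset.rfl hz
  · exact f.2.2.2.2 z hz

theorem eventuallyEq_zero_of_iteratedDeriv {f : OSpace ν K n} {x : ℂ} (hx : x ∈ U K n)
    (h : ∀ m, iteratedDeriv m f x = 0) : f =ᶠ[𝓝 x] (0 : ℂ → ℂ) := by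
  obtain ⟨r, hr, hsub⟩ := Metric.isOpen_iff.1 (isOpen_U K n) x hx
  filter_upwards [Metric.ball_mem_nhds x hr] with z hz
  have h1 := Complex.hasSum_taylorSeries_on_ball (f.2.1.mono hsub) hz
  simp only [h, smul_zero] at h1
  exact h1.unique hasSum_zero

end OSpace

/-! ### The linking maps -/

section Restrict

variable {ν : Weights} {K : Set EReal} {n k : ℕ+}

theorem norm_restrict_le (h : n ≤ k) (f : OSpace ν K n) : ‖restrict ν K n k h f‖ ≤ ‖f‖ := by
  refine OSpace.norm_le_of_norm_apply_le (norm_nonneg f) fun z hz => ?_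
  rw [restrict_apply h f hz, mul_comm]
  exact (OSpace.norm_apply_le f z).trans
    (mul_le_mul_of_nonneg_right (ν.mono' n k h z) (norm_nonneg f))

theorem restrict_eventuallyEq (h : n ≤ k) (f : OSpace ν K n) {x : ℂ} (hx : x ∈ U K k) :
    restrict ν K n k h f =ᶠ[𝓝 x] (f : ℂ → ℂ) := by
  filter_upwards [(isOpen_U K k).mem_nhds hx] with z hz
  exact restrict_apply h f (subset_closure hz)

/-- The linking map as a continuous linear map. -/
def restrictL (ν : Weights) (K : Set EReal) (n k : ℕ+) (h : n ≤ k) :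
    OSpace ν K n →L[ℂ] OSpace ν K k :=
  (restrict ν K n k h).mkContinuous 1 fun f => by
    rw [one_mul]; exact norm_restrict_le h f

theorem restrictL_apply (h : n ≤ k) (f : OSpace ν K n) :
    restrictL ν K n k h f = restrict ν K n k h f := rfl

/-- Each ball or half-strip making up `U K n` meets `U K k`, so vanishing on the latter propagates.
-/
theorem restrict_injective (h : n ≤ k) : Function.Injective (restrict ν K n k h) := by
  refine (injective_iff_map_eq_zero _).2 fun f hf => ?_
  have hk : (0 : ℝ) < 1 / (k : ℝ) := one_div_pos.2 (by exact_mod_cast k.pos)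
  have hnk : (n : ℝ) < k + 1 := by
    have : (n : ℝ) ≤ k := by exact_mod_cast h
    linarith
  have hU : ∀ x ∈ U K k, f =ᶠ[𝓝 x] (0 : ℂ → ℂ) := fun x hx => by
    have h1 := restrict_eventuallyEq h f hx
    rw [hf] at h1
    exact h1.symm
  refine OSpace.eq_zero_of_eventuallyEq
    (fun x hx => hU x (ofReal_mem_U hx (by exact_mod_cast k.pos)))
    (fun ht => ⟨k + 1, hnk, hU _ (Or.inl (Or.inr ⟨ht, ?_, ?_⟩))⟩)
    (fun hb => ⟨-(k + 1), neg_lt_neg hnk, hU _ (Or.inr ⟨hb, ?_, ?_⟩)⟩)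
  · rw [Complex.ofReal_re]; exact lt_add_one _
  · rw [Complex.ofReal_im, abs_zero]; exact hk
  · rw [Complex.ofReal_re]; exact neg_lt_neg (lt_add_one _)
  · rw [Complex.ofReal_im, abs_zero]; exact hk

/-- The linking maps are compact if the quotient of the weights vanishes at infinity. -/
theorem isCompactOperator_restrictL (h : n < k)
    (hν : ∀ ε : ℝ, 0 < ε → ∃ Q : Set ℂ, IsCompact Q ∧ Q ⊆ closure (U K k) ∧
      ∀ z ∈ closure (U K k) \ Q, ν n z ≤ ε * ν k z) :
    IsCompactOperator (restrictL ν K n k h.le) := by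
  have htb : TotallyBounded (restrictL ν K n k h.le '' Metric.closedBall 0 1) := by
    refine Metric.totallyBounded_iff.2 fun ε hε => ?_
    -- Off `Q`, `‖f - g‖ ≤ 2` and the factor `ε / 4` give `ε / 2`. On `Q`, a uniform error `ε / 2 *
    -- c` suffices since `ν k ≥ c > 0` there.
    obtain ⟨Q, hQ, hQU, hQν⟩ := hν (ε / 4) (by positivity)
    obtain ⟨c, hc, hcQ⟩ := hQ.exists_forall_le' (ν.continuous' k).continuousOn
      (fun z _ => ν.pos' k z)
    obtain ⟨t, htf, ht1, ht⟩ := OSpace.exists_finite_approx (ν := ν) hQ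
      (hQU.trans (closure_U_subset_pnat K h)) (ε := ε / 2 * c) (by positivity)
    refine ⟨restrictL ν K n k h.le '' t, htf.image _, ?_⟩
    rintro _ ⟨f, hf, rfl⟩
    rw [mem_closedBall_zero_iff] at hf
    obtain ⟨g, hg, hfg⟩ := ht f hf
    refine mem_iUnion₂.2 ⟨_, ⟨g, hg, rfl⟩, ?_⟩
    rw [Metric.mem_ball, dist_eq_norm, ← map_sub]
    refine (OSpace.norm_le_of_norm_apply_le (half_pos hε).le fun z hz => ?_).trans_lt
      (half_lt_self hε)
    rw [restrictL_apply, restrict_apply _ _ hz]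
    by_cases hzQ : z ∈ Q
    · exact (hfg z hzQ).le.trans (mul_le_mul_of_nonneg_left (hcQ z hzQ) (half_pos hε).le)
    · have h1 := OSpace.norm_apply_le (f - g) z
      have h2 : ‖f - g‖ ≤ 2 := (norm_sub_le f g).trans (by linarith [ht1 g hg])
      have h3 := hQν z ⟨hz, hzQ⟩
      have h4 := mul_le_mul_of_nonneg_left h2 (ν.pos' n z).le
      linarith
  refine (isCompactOperator_iff_isCompact_closure_image_closedBall
    (restrictL ν K n k h.le : OSpace ν K n →ₗ[ℂ] OSpace ν K k) one_pos).2 ?_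
  exact isCompact_iff_totallyBounded_isComplete.2 ⟨htb.closure, isClosed_closure.isComplete⟩

end Restrict

/-! ### The inductive limit -/

namespace OVind

variable {ν : Weights} {K : Set EReal}

theorem of_restrict {n k : ℕ+} (h : n ≤ k) (f : OSpace ν K n) :
    of ν K k (restrict ν K n k h f) = of ν K n f :=
  Module.DirectLimit.of_f

theorem of_injective (n : ℕ+) : Function.Injective (of ν K n) := by
  refine (injective_iff_map_eq_zero _).2 fun f hf => ?_
  obtain ⟨k, h, hk⟩ := Module.DirectLimit.of.zero_exact hf
  exact restrict_injective h (hk.trans (map_zero _).symm)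

theorem exists_of (e : OVind ν K) : ∃ n f, of ν K n f = e := Module.DirectLimit.exists_of e

/-- Restriction keeps the germ at `x`, so the evaluations on the steps are compatible; continuity is
checked step by step. -/
theorem exists_pointEvaluation {x : ℝ} (hx : (x : EReal) ∈ K) (m : ℕ) :
    ∃ T : StrongDual ℂ (OVind ν K), IsPointEvaluation T x m := by
  have hU : ∀ n : ℕ+, (x : ℂ) ∈ U K n := fun n => ofReal_mem_U hx (by exact_mod_cast n.pos)
  have hd : ∀ (n : ℕ+) (f : OSpace ν K n), ContDiffAt ℂ m f (x : ℂ) := fun n f =>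
    (f.analyticOnNhd _ (hU n)).contDiffAt
  let g : ∀ n : ℕ+, OSpace ν K n →ₗ[ℂ] ℂ := fun n =>
    { toFun := fun f => iteratedDeriv m f (x : ℂ)
      map_add' := fun f g => iteratedDeriv_add (hd n f) (hd n g)
      map_smul' := fun c f => iteratedDeriv_const_smul (hd n f) c }
  let T : OVind ν K →ₗ[ℂ] ℂ := Module.DirectLimit.lift ℂ ℕ+ (OSpace ν K) (restrict ν K) g
    fun n k h f => (restrict_eventuallyEq h f (hU k)).iteratedDeriv_eq m
  have hT : ∀ n f, T (of ν K n f) = g n f := fun n f => Module.DirectLimit.lift_of g _ f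
  refine ⟨⟨T, continuous_inductiveTopology_dom T fun n => ?_⟩, hT⟩
  obtain ⟨C, hC⟩ := OSpace.exists_iteratedDeriv_bound (ν := ν) (hU n) m
  refine AddMonoidHomClass.continuous_of_bound (T ∘ₗ of ν K n) C fun f => ?_
  rw [LinearMap.comp_apply, hT]
  exact hC f

/-- Along a suitable sequence of steps, the inductive limit is a compact union. -/
theorem exists_isCompactUnion (hν : WeightCondition ν K) :
    ∃ (N : ℕ → ℕ+) (hN : ∀ k, N k ≤ N (k + 1)),
      IsCompactUnion (fun k => restrictL ν K (N k) (N (k + 1)) (hN k)) (fun k => of ν K (N k)) ∧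
      inductiveTopology (of ν K) = inductiveTopology (fun k => of ν K (N k)) := by
  choose M hM hMν using hν
  -- Iterating the choice of `m` from the weight condition makes consecutive links compact; strict
  -- growth makes the sequence cofinal.
  let N : ℕ → ℕ+ := fun k => Nat.rec (motive := fun _ => ℕ+) 1 (fun _ n => M n) k
  have hN : ∀ k, N k < N (k + 1) := fun k => hM (N k)
  have hk : ∀ k, k < (N k : ℕ) := by
    intro k
    induction k with
    | zero => exact (N 0).pos
    | succ k ih => exact lt_of_le_of_lt ih (PNat.coe_lt_coe _ _ |>.2 (hN k))
  have hle : ∀ n : ℕ+, n ≤ N n := fun n => (PNat.coe_le_coe _ _).1 (hk n).le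
  refine ⟨N, fun k => (hN k).le, ⟨fun k => isCompactOperator_restrictL (hN k) (hMν (N k)),
    fun k f => norm_restrict_le (hN k).le f,
    fun k f => of_restrict (hN k).le f, fun k => of_injective _,
    fun e => ?_⟩, ?_⟩
  · obtain ⟨n, f, rfl⟩ := exists_of e
    exact ⟨n, restrict ν K n (N n) (hle n) f, of_restrict _ f⟩
  -- Both infima run over the same topologies, since step `n` factors continuously through step `N
  -- n`.
  · refine congrArg sInf (Set.ext fun t => and_congr_right fun _ => and_congr_right fun _ =>
      and_congr_right fun _ => ⟨fun h k => h (N k), fun h n => ?_⟩)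
    have h1 := (h n).comp (restrictL ν K n (N n) (hle n)).continuous
    refine h1.congr fun f => ?_
    exact of_restrict (hle n) f

/-- A family of point evaluations that annihilates no nonzero element of any step spans a dense
subspace of the strong dual. -/
theorem dense_span_of_separating (hν : WeightCondition ν K) (S : Set (StrongDual ℂ (OVind ν K)))
    (hS : ∀ n f, (∀ T ∈ S, T (of ν K n f) = 0) → f = 0) :
    Dense (Submodule.span ℂ S : Set (StrongDual ℂ (OVind ν K))) := by
  obtain ⟨N, hN, h, ht⟩ := exists_isCompactUnion hν
  refine h.dense_span_of_separating ht S fun e he => ?_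
  obtain ⟨n, f, rfl⟩ := exists_of e
  rw [hS n f he, map_zero]

/-- The inductive limit is a (DFS)-space. -/
theorem isDFSSpace (hν : WeightCondition ν K) : IsDFSSpace (OVind ν K) := by
  obtain ⟨N, hN, h, ht⟩ := exists_isCompactUnion hν
  exact ⟨h.t2Space ht, fun k => OSpace ν K (N k), inferInstance, inferInstance, _, _,
    inferInstance, fun k => restrict_injective (hN k), h.compact, h.comp, h.injective,
    h.exists_eq, ht⟩

/-- Density of the span of the point evaluations of derivatives in the strong dual. -/
theorem dense_span_derivatives (hν : WeightCondition ν K)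
    (hK' : (∀ p ∈ K, ∃ x : ℝ, p = (x : EReal)) ∨
      (∀ p ∈ K, (p = ⊤ ∨ p = ⊥) → AccPt p (𝓟 K))) :
    Dense (Submodule.span ℂ {T : StrongDual ℂ (OVind ν K) |
      ∃ x : ℝ, (x : EReal) ∈ K ∧ ∃ m : ℕ, IsPointEvaluation T x m} :
        Set (StrongDual ℂ (OVind ν K))) := by
  refine dense_span_of_separating hν _ fun n f hf => ?_
  have hzero : ∀ x : ℝ, (x : EReal) ∈ K → f =ᶠ[𝓝 (x : ℂ)] (0 : ℂ → ℂ) := fun x hx => by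
    refine OSpace.eventuallyEq_zero_of_iteratedDeriv
      (ofReal_mem_U hx (by exact_mod_cast n.pos)) fun m => ?_
    obtain ⟨T, hT⟩ := exists_pointEvaluation (ν := ν) hx m
    rw [← hT n f]
    exact hf T ⟨x, hx, m, hT⟩
  -- For `K` inside the reals this holds vacuously, which merges the two alternatives.
  have hacc : ∀ p ∈ K, (p = ⊤ ∨ p = ⊥) → AccPt p (𝓟 K) := by
    rcases hK' with hR | hA
    · intro p hp hp'
      obtain ⟨x, rfl⟩ := hR p hp
      simp at hp'
    · exact hA
  refine OSpace.eq_zero_of_eventuallyEq hzero (fun htop => ?_) (fun hbot => ?_)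
  · obtain ⟨x, hx, hnx⟩ := exists_real_gt_of_accPt_top (hacc ⊤ htop (Or.inl rfl)) n
    exact ⟨x, hnx, hzero x hx⟩
  · obtain ⟨x, hx, hnx⟩ := exists_real_lt_of_accPt_bot (hacc ⊥ hbot (Or.inr rfl)) (-n)
    exact ⟨x, hnx, hzero x hx⟩

/-- Density of the span of the point evaluations in the strong dual if `K` is perfect. -/
theorem dense_span_evaluations (hν : WeightCondition ν K) (hK' : ∀ p ∈ K, AccPt p (𝓟 K)) :
    Dense (Submodule.span ℂ {T : StrongDual ℂ (OVind ν K) |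
      ∃ x : ℝ, (x : EReal) ∈ K ∧ IsPointEvaluation T x 0} :
        Set (StrongDual ℂ (OVind ν K))) := by
  refine dense_span_of_separating hν _ fun n f hf => ?_
  have hval : ∀ x : ℝ, (x : EReal) ∈ K → f (x : ℂ) = 0 := fun x hx => by
    obtain ⟨T, hT⟩ := exists_pointEvaluation (ν := ν) hx 0
    have h1 := hT n f
    rw [iteratedDeriv_zero] at h1
    rw [← h1]
    exact hf T ⟨x, hx, hT⟩
  have hzero : ∀ x : ℝ, (x : EReal) ∈ K → f =ᶠ[𝓝 (x : ℂ)] (0 : ℂ → ℂ) := fun x hx => by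
    -- Zeros of `f` at the points of `K` accumulate at `x`.
    refine (f.analyticOnNhd _ (ofReal_mem_U hx
      (by exact_mod_cast n.pos))).frequently_zero_iff_eventually_zero.1 ?_
    refine (frequently_mem_of_accPt (hK' x hx)).mono ?_
    rintro _ ⟨y, hy, rfl⟩
    exact hval y hy
  refine OSpace.eq_zero_of_eventuallyEq hzero (fun htop => ?_) (fun hbot => ?_)
  · obtain ⟨x, hx, hnx⟩ := exists_real_gt_of_accPt_top (hK' ⊤ htop) n
    exact ⟨x, hnx, hzero x hx⟩
  · obtain ⟨x, hx, hnx⟩ := exists_real_lt_of_accPt_bot (hK' ⊥ hbot) (-n)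
    exact ⟨x, hnx, hzero x hx⟩

end OVind

end WeightedGerms

end

theorem mainTheorem9 (K : Set EReal) (hK : IsCompact K) (hne : K.Nonempty)
    (ν : WeightedGerms.Weights) (hν : WeightedGerms.WeightCondition ν K) :
    -- the inductive limit exists (as a Hausdorff space containing all steps) and is (DFS)
    ((∀ n : ℕ+, Function.Injective (WeightedGerms.OVind.of ν K n)) ∧
      T2Space (WeightedGerms.OVind ν K) ∧
      WeightedGerms.IsDFSSpace (WeightedGerms.OVind ν K)) ∧
    -- the point evaluations of derivatives are continuous linear functionals on it
    (∀ x : ℝ, (x : EReal) ∈ K → ∀ m : ℕ, ∃ T : StrongDual ℂ (WeightedGerms.OVind ν K),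
      WeightedGerms.IsPointEvaluation T x m) ∧
    -- density of the span of point evaluations of derivatives in the strong dual
    (((∀ p ∈ K, ∃ x : ℝ, p = (x : EReal)) ∨
        (∀ p ∈ K, (p = ⊤ ∨ p = ⊥) → AccPt p (Filter.principal K))) →
      Dense (Submodule.span ℂ {T : StrongDual ℂ (WeightedGerms.OVind ν K) |
        ∃ x : ℝ, (x : EReal) ∈ K ∧ ∃ m : ℕ, WeightedGerms.IsPointEvaluation T x m} :
          Set (StrongDual ℂ (WeightedGerms.OVind ν K)))) ∧
    -- density of the span of point evaluations in the strong dual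
    ((∀ p ∈ K, AccPt p (Filter.principal K)) →
      Dense (Submodule.span ℂ {T : StrongDual ℂ (WeightedGerms.OVind ν K) |
        ∃ x : ℝ, (x : EReal) ∈ K ∧ WeightedGerms.IsPointEvaluation T x 0} :
          Set (StrongDual ℂ (WeightedGerms.OVind ν K)))) := by
  have h := WeightedGerms.OVind.isDFSSpace hν
  exact ⟨⟨WeightedGerms.OVind.of_injective, h.1, h⟩,
    fun x hx m => WeightedGerms.OVind.exists_pointEvaluation hx m,
    WeightedGerms.OVind.dense_span_derivatives hν, WeightedGerms.OVind.dense_span_evaluations hν⟩
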